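/- Let $\alpha,\beta>0$, $\gamma\in\mathbb R$, let $n\ge 0$ be an integer, and for $t<0$ let $$D_n(t)=\det\left(\int_0^1 x^{j+k}\,(x-t)^{\gamma}x^{\alpha}(1-x)^{\beta}\,dx\right)_{j,k=0}^{n-1}$$ (with $D_0=1$) be the Hankel determinant of the generalized Jacobi weight. Then $D_n$ is positive and differentiable on $(-\infty,0)$. Put, for $t<0$, $$H_n(t)=t(t-1)\frac{d}{dt}\ln D_n(t),\qquad \widetilde H_n(t)=H_n(t)+d_1t+d_2,$$ where $$d_1=-n(n+\alpha+\beta+\gamma)-\frac{(\alpha+\beta)^2}{4},\qquad d_2=\frac14\Bigl[2n(n+\alpha+\beta+\gamma)+\beta(\alpha+\beta)-\gamma(\alpha-\beta)\Bigr].$$ Then $\widetilde H_n$ is twice differentiable on $(-\infty,0)$ and satisfies, for every $t<0$, the Jimbo–Miwa–Okamoto $\sigma$-form of Painlevé VI $$\widetilde H_n'\bigl(t(t-1)\widetilde H_n''\bigr)^2+\Bigl\{2\widetilde H_n'\bigl(t\widetilde H_n'-\widetilde H_n\bigr)-(\widetilde H_n')^2-\nu_1\nu_2\nu_3\nu_4\Bigr\}^2=\prod_{i=1}^4\bigl(\widetilde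 H_n'+\nu_i^2\bigr)$$ with $$\nu_1=\frac{\alpha+\beta}{2},\qquad \nu_2=\frac{\beta-\alpha}{2},\qquad \nu_3=\frac{2n+\alpha+\beta}{2},\qquad \nu_4=\frac{2n+\alpha+\beta+2\gamma}{2}.$$ -/

import Mathlib

noncomputable section

/-- The generalized Jacobi weight `(x - t)^γ x^α (1 - x)^β`. -/
def genJacobiWeight (α β γ t x : ℝ) : ℝ :=
  (x - t) ^ γ * x ^ α * (1 - x) ^ β

/-- The `k`-th moment of the generalized Jacobi weight on `[0, 1]`. -/
def genJacobiMoment (α β γ t : ℝ) (k : ℕ) : ℝ :=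
  ∫ x in (0 : ℝ)..1, x ^ k * genJacobiWeight α β γ t x

/-- The Hankel determinant `D_n(t)` of the generalized Jacobi weight, of size `n`. -/
def hankelD (n : ℕ) (α β γ t : ℝ) : ℝ :=
  Matrix.det (Matrix.of fun j k : Fin n => genJacobiMoment α β γ t ((j : ℕ) + (k : ℕ)))

/-- `H_n(t) = t (t - 1) (d/dt) ln D_n(t)`. -/
def hankelH (n : ℕ) (α β γ t : ℝ) : ℝ :=
  t * (t - 1) * deriv (fun s : ℝ => Real.log (hankelD n α β γ s)) t

/-- The constant `d_1`. -/
def shiftOne (n : ℕ) (α β γ : ℝ) : ℝ :=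
  -((n : ℝ) * ((n : ℝ) + α + β + γ)) - (α + β) ^ 2 / 4

/-- The constant `d_2`. -/
def shiftTwo (n : ℕ) (α β γ : ℝ) : ℝ :=
  (1 / 4) * (2 * (n : ℝ) * ((n : ℝ) + α + β + γ) + β * (α + β) - γ * (α - β))

/-- The shifted logarithmic derivative `H_n(t) + d_1 t + d_2`. -/
def hankelHTilde (n : ℕ) (α β γ t : ℝ) : ℝ :=
  hankelH n α β γ t + shiftOne n α β γ * t + shiftTwo n α β γ

/-- The function `σ` is twice differentiable at `t` and satisfies there the Jimbo-Miwa-Okamoto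
`σ`-form of Painlevé VI with parameters `ν₁, ν₂, ν₃, ν₄`. -/
def SatisfiesPVISigmaForm (ν₁ ν₂ ν₃ ν₄ : ℝ) (σ : ℝ → ℝ) (t : ℝ) : Prop :=
  DifferentiableAt ℝ σ t ∧ DifferentiableAt ℝ (deriv σ) t ∧
    deriv σ t * (t * (t - 1) * deriv (deriv σ) t) ^ 2
      + (2 * deriv σ t * (t * deriv σ t - σ t) - (deriv σ t) ^ 2 - ν₁ * ν₂ * ν₃ * ν₄) ^ 2
      = (deriv σ t + ν₁ ^ 2) * (deriv σ t + ν₂ ^ 2) * (deriv σ t + ν₃ ^ 2)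
        * (deriv σ t + ν₄ ^ 2)

end

/-!
# The Hankel determinant of the generalized Jacobi weight and Painlevé VI

Let `n = m + 1`, let `P` be the monic orthogonal polynomial of degree `n` for the weight `w`, and
let `Q` be the polynomial of degree at most `n - 1` whose integral against `x ^ j`, `j < n`, is `1`
for `j = n - 1` and `0` otherwise. The linear differential equation in `x` satisfied by `(P, Q)` and
its Cauchy transforms has simple poles at `0`, `1`, `t`, and the entries of its residue matrices are
`θ ∫ P² w / (x - s)`, `θ ∫ P Q w / (x - s)`, `θ ∫ Q² w / (x - s)` for `(s, θ)` equal to `(0, α)`,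
`(1, β)`, `(t, γ)`. These integrals are used directly, and the differential equation itself is
never needed.

* The Wronskian identity for `P`, `Q` and their Cauchy transforms fixes the determinants of the
  residue matrices (`IsOrthoPair.cauchy_det`). Integration by parts against `P²`, `PQ`, `Q²` and
  their multiples by `x` gives six linear relations. Together they express every invariant that
  occurs through two quantities only: the subleading coefficient `p` of `P` and the diagonal
  residue `r = γ ∫ P Q w / (x - t)`. In particular the square of the commutator of two residue
  matrices is a polynomial in `p`, `r`, `t` (`IsOrthoPair.commutator_sq`).
* Differentiating the orthogonality relations in `t` gives `p' = r`, and, by the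
  Christoffel-Darboux formula, the Schlesinger equation: `t (t - 1) r'` is that commutator
  (`hasDerivAt_subleadingCoeff`, `hasDerivAt_residuePole`).
* Jacobi's formula and the linear relation between `t (t - 1) dμ_k/dt`, `μ_{k+1}` and `μ_k` for the
  moments `μ_k` show that `H_n = -(2n + α + β + γ) p + n γ t - n (n + α + γ)` (`hankelH_succ`).

Hence the shifted function and its first derivative are affine in `p` and `r`, its second
derivative is a multiple of the commutator divided by `t (t - 1)`, and the `σ`-form is the formula
for the square of the commutator, rewritten (`sigma_form_of_lax_invariants`).
-/

noncomputable section
open Polynomial MeasureTheory intervalIntegral Set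

/-! ### Integrals against the generalized Jacobi weight -/

/-- The integral `∫₀¹ f(x) (x - t)^c x^a (1 - x)^b dx` of a polynomial `f` against the generalized
Jacobi weight. It is linear in `f` when `-1 < a`, `-1 < b` and `t < 0`. -/
def jacobiInt (a b c t : ℝ) (f : ℝ[X]) : ℝ :=
  ∫ x in (0 : ℝ)..1, f.eval x * genJacobiWeight a b c t x

theorem intervalIntegrable_rpow_mul_one_sub_rpow {a b : ℝ} (ha : -1 < a) (hb : -1 < b) :
    IntervalIntegrable (fun x : ℝ => x ^ a * (1 - x) ^ b) volume 0 1 := by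
  have h := (Complex.betaIntegral_convergent (u := ((a + 1 : ℝ) : ℂ)) (v := ((b + 1 : ℝ) : ℂ))
    (by simp; linarith) (by simp; linarith)).norm
  refine h.congr_uIoo fun x hx => ?_
  rw [uIoo_of_le zero_le_one] at hx
  have h1 : (0 : ℝ) < 1 - x := by linarith [hx.2]
  have e1 : ((a + 1 : ℝ) : ℂ) - 1 = (a : ℂ) := by push_cast; ring
  have e2 : ((b + 1 : ℝ) : ℂ) - 1 = (b : ℂ) := by push_cast; ring
  have e3 : (1 : ℂ) - (x : ℂ) = ((1 - x : ℝ) : ℂ) := by push_cast; ring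
  simp only [e1, e2, e3, norm_mul, Complex.norm_cpow_eq_rpow_re_of_pos hx.1,
    Complex.norm_cpow_eq_rpow_re_of_pos h1, Complex.ofReal_re]

theorem continuousOn_sub_rpow {c t : ℝ} (ht : t < 0) :
    ContinuousOn (fun x : ℝ => (x - t) ^ c) (Icc 0 1) :=
  ContinuousOn.rpow_const (by fun_prop) fun x hx => Or.inl (by linarith [hx.1])

theorem intervalIntegrable_mul_genJacobiWeight {a b c t : ℝ} (ha : -1 < a) (hb : -1 < b)
    (ht : t < 0) {g : ℝ → ℝ} (hg : ContinuousOn g (Icc 0 1)) :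
    IntervalIntegrable (fun x => g x * genJacobiWeight a b c t x) volume 0 1 := by
  have h := (intervalIntegrable_rpow_mul_one_sub_rpow ha hb).continuousOn_mul
    (g := fun x => g x * (x - t) ^ c)
    (by rw [uIcc_of_le zero_le_one]; exact hg.mul (continuousOn_sub_rpow ht))
  refine h.congr_uIoo fun x _ => ?_
  simp only [genJacobiWeight]; ring

section Linear
variable {a b c t : ℝ} (ha : -1 < a) (hb : -1 < b) (ht : t < 0)
include ha hb ht

theorem intervalIntegrable_eval_mul_genJacobiWeight (f : ℝ[X]) :
    IntervalIntegrable (fun x => f.eval x * genJacobiWeight a b c t x) volume 0 1 :=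
  intervalIntegrable_mul_genJacobiWeight ha hb ht f.continuousOn

theorem jacobiInt_add (f g : ℝ[X]) :
    jacobiInt a b c t (f + g) = jacobiInt a b c t f + jacobiInt a b c t g := by
  simp only [jacobiInt, eval_add, add_mul]
  exact integral_add (intervalIntegrable_eval_mul_genJacobiWeight ha hb ht f)
    (intervalIntegrable_eval_mul_genJacobiWeight ha hb ht g)

omit ha hb ht in
theorem jacobiInt_smul (r : ℝ) (f : ℝ[X]) :
    jacobiInt a b c t (r • f) = r * jacobiInt a b c t f := by
  simp only [jacobiInt, eval_smul, smul_eq_mul, mul_assoc]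
  exact intervalIntegral.integral_const_mul _ _

end Linear

/-- `jacobiInt` as a linear functional on polynomials. -/
def jacobiFunctional {a b c t : ℝ} (ha : -1 < a) (hb : -1 < b) (ht : t < 0) : ℝ[X] →ₗ[ℝ] ℝ where
  toFun := jacobiInt a b c t
  map_add' := jacobiInt_add ha hb ht
  map_smul' := jacobiInt_smul

theorem jacobiInt_X_mul {a b c t : ℝ} (f : ℝ[X]) :
    jacobiInt a b c t (X * f) = jacobiInt (a + 1) b c t f := by
  refine integral_congr_Ioo_of_le zero_le_one fun x hx => ?_
  simp only [genJacobiWeight, eval_mul, eval_X, Real.rpow_add_one hx.1.ne']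
  ring

theorem jacobiInt_one_sub_X_mul {a b c t : ℝ} (f : ℝ[X]) :
    jacobiInt a b c t ((1 - X) * f) = jacobiInt a (b + 1) c t f := by
  refine integral_congr_Ioo_of_le zero_le_one fun x hx => ?_
  have h : (1 : ℝ) - x ≠ 0 := by linarith [hx.2]
  simp only [genJacobiWeight, eval_mul, eval_sub, eval_one, eval_X, Real.rpow_add_one h]
  ring

theorem jacobiInt_X_sub_C_mul {a b c t : ℝ} (ht : t < 0) (f : ℝ[X]) :
    jacobiInt a b c t ((X - C t) * f) = jacobiInt a b (c + 1) t f := by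
  refine integral_congr_Ioo_of_le zero_le_one fun x hx => ?_
  have h : x - t ≠ 0 := by linarith [hx.1]
  simp only [genJacobiWeight, eval_mul, eval_sub, eval_C, eval_X, Real.rpow_add_one h]
  ring

/-- Integration by parts: as `a, b > 0`, the weight vanishes at both endpoints. -/
theorem jacobiInt_derivative {a b c t : ℝ} (ha : 0 < a) (hb : 0 < b) (ht : t < 0) (f : ℝ[X]) :
    jacobiInt a b c t (derivative f) + a * jacobiInt (a - 1) b c t f
      - b * jacobiInt a (b - 1) c t f + c * jacobiInt a b (c - 1) t f = 0 := by
  have I0 := intervalIntegrable_eval_mul_genJacobiWeight (a := a) (b := b) (c := c)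
    (by linarith) (by linarith) ht (derivative f)
  have I1 := (intervalIntegrable_eval_mul_genJacobiWeight (a := a - 1) (b := b) (c := c)
    (by linarith) (by linarith) ht f).const_mul a
  have I2 := (intervalIntegrable_eval_mul_genJacobiWeight (a := a) (b := b - 1) (c := c)
    (by linarith) (by linarith) ht f).const_mul b
  have I3 := (intervalIntegrable_eval_mul_genJacobiWeight (a := a) (b := b) (c := c - 1)
    (by linarith) (by linarith) ht f).const_mul c
  have key := integral_eq_sub_of_hasDerivAt_of_le (a := 0) (b := 1)
    (f := fun x => f.eval x * genJacobiWeight a b c t x)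
    (f' := fun x => (derivative f).eval x * genJacobiWeight a b c t x
      + a * (f.eval x * genJacobiWeight (a - 1) b c t x)
      - b * (f.eval x * genJacobiWeight a (b - 1) c t x)
      + c * (f.eval x * genJacobiWeight a b (c - 1) t x)) zero_le_one
    (f.continuousOn.mul (((continuousOn_sub_rpow ht).mul
      ((continuous_id.rpow_const fun _ => Or.inr ha.le).continuousOn)).mul
      (((continuous_const.sub continuous_id).rpow_const fun _ => Or.inr hb.le).continuousOn)))
    (fun x hx => by
      have hx0 : x ≠ 0 := hx.1.ne'
      have hx1 : 1 - x ≠ 0 := by linarith [hx.2]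
      have hxt : x - t ≠ 0 := by linarith [hx.1]
      have d1 := ((hasDerivAt_id x).sub_const t).rpow_const (p := c) (Or.inl hxt)
      have d2 := (hasDerivAt_id x).rpow_const (p := a) (Or.inl hx0)
      have d3 := ((hasDerivAt_id x).const_sub 1).rpow_const (p := b) (Or.inl hx1)
      refine ((f.hasDerivAt x).mul ((d1.mul d2).mul d3)).congr_deriv ?_
      simp only [genJacobiWeight, id, Pi.mul_apply]
      ring)
    (((I0.add I1).sub I2).add I3)
  have w0 : genJacobiWeight a b c t 0 = 0 := by simp [genJacobiWeight, Real.zero_rpow ha.ne']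
  have w1 : genJacobiWeight a b c t 1 = 0 := by simp [genJacobiWeight, Real.zero_rpow hb.ne']
  rw [w0, w1, mul_zero, mul_zero, sub_zero] at key
  simp only [jacobiInt]
  rw [← intervalIntegral.integral_const_mul, ← intervalIntegral.integral_const_mul,
    ← intervalIntegral.integral_const_mul, ← intervalIntegral.integral_add I0 I1,
    ← intervalIntegral.integral_sub (I0.add I1) I2,
    ← intervalIntegral.integral_add ((I0.add I1).sub I2) I3]
  exact key

theorem jacobiInt_mul_self_pos {a b c t : ℝ} (ha : 0 < a) (hb : 0 < b) (ht : t < 0) {f : ℝ[X]}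
    (hf : f ≠ 0) : 0 < jacobiInt a b c t (f * f) := by
  have hw : ∀ x ∈ Ioo (0 : ℝ) 1, 0 < genJacobiWeight a b c t x := fun x hx =>
    mul_pos (mul_pos (Real.rpow_pos_of_pos (by linarith [hx.1]) _) (Real.rpow_pos_of_pos hx.1 _))
      (Real.rpow_pos_of_pos (by linarith [hx.2]) _)
  refine integral_pos zero_lt_one ((f * f).continuousOn.mul (((continuousOn_sub_rpow ht).mul
      ((continuous_id.rpow_const fun _ => Or.inr ha.le).continuousOn)).mul
      (((continuous_const.sub continuous_id).rpow_const fun _ => Or.inr hb.le).continuousOn)))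
    (fun x hx => ?_) ?_
  · rw [eval_mul]
    refine mul_nonneg (mul_self_nonneg _) (mul_nonneg (mul_nonneg ?_ ?_) ?_) <;>
      exact Real.rpow_nonneg (by linarith [hx.1, hx.2]) _
  · obtain ⟨x, hx, hfx⟩ := (Ioo_infinite (zero_lt_one' ℝ)).exists_notMem_finset f.roots.toFinset
    have hfx' : f.eval x ≠ 0 := fun h => hfx (by simp [hf, h])
    refine ⟨x, Ioo_subset_Icc_self hx, mul_pos ?_ (hw x hx)⟩
    rw [eval_mul]
    exact mul_self_pos.2 hfx'

theorem hasDerivAt_jacobiInt {a b t : ℝ} (c : ℝ) (ha : -1 < a) (hb : -1 < b) (ht : t < 0)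
    (f : ℝ[X]) :
    HasDerivAt (fun s => jacobiInt a b c s f) (-c * jacobiInt a b (c - 1) t f) t := by
  -- On the ball of radius `-t/2` about `t` the quantity `x - s` stays in a compact subset of
  -- the positive reals.
  have hcpt : IsCompact (Icc (-t / 2) (1 - 3 * t / 2)) := isCompact_Icc
  obtain ⟨K, hK⟩ := hcpt.exists_bound_of_continuousOn (f := fun y : ℝ => y ^ (c - 1))
    (ContinuousOn.rpow_const continuousOn_id fun y hy => Or.inl (by
      exact (show (0 : ℝ) < y by linarith [hy.1]).ne'))
  have hs : ∀ s ∈ Metric.ball t (-t / 2), 3 * t / 2 < s ∧ s < t / 2 := fun s hs => by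
    rw [Metric.mem_ball, Real.dist_eq, abs_lt] at hs
    constructor <;> linarith [hs.1, hs.2]
  have main := intervalIntegral.hasDerivAt_integral_of_dominated_loc_of_deriv_le
    (μ := volume) (a := 0) (b := 1) (x₀ := t) (s := Metric.ball t (-t / 2))
    (F := fun s x => f.eval x * genJacobiWeight a b c s x)
    (F' := fun s x => -c * (f.eval x * genJacobiWeight a b (c - 1) s x))
    (bound := fun x => |c| * |K| * |f.eval x * (x ^ a * (1 - x) ^ b)|)
    (Metric.ball_mem_nhds t (by linarith))
    (by
      filter_upwards [Iio_mem_nhds ht] with s hs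
      exact (intervalIntegrable_iff.1
        (intervalIntegrable_eval_mul_genJacobiWeight ha hb hs f)).aestronglyMeasurable)
    (intervalIntegrable_eval_mul_genJacobiWeight ha hb ht f)
    (intervalIntegrable_iff.1 ((intervalIntegrable_eval_mul_genJacobiWeight ha hb ht
      f).const_mul (-c))).aestronglyMeasurable
    (Filter.Eventually.of_forall fun x hx s hsb => by
      rw [uIoc_of_le zero_le_one] at hx
      obtain ⟨h1, h2⟩ := hs s hsb
      have hk := hK (x - s) ⟨by linarith [hx.1], by linarith [hx.2]⟩
      have e : -c * (f.eval x * genJacobiWeight a b (c - 1) s x)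
          = -c * (x - s) ^ (c - 1) * (f.eval x * (x ^ a * (1 - x) ^ b)) := by
        simp only [genJacobiWeight]; ring
      rw [e, norm_mul, norm_mul, norm_neg, Real.norm_eq_abs c]
      exact mul_le_mul_of_nonneg_right (mul_le_mul_of_nonneg_left (hk.trans (le_abs_self K))
        (abs_nonneg c)) (abs_nonneg _))
    ((((intervalIntegrable_rpow_mul_one_sub_rpow ha hb).continuousOn_mul
      f.continuousOn).abs).const_mul _)
    (Filter.Eventually.of_forall fun x hx s hsb => by
      rw [uIoc_of_le zero_le_one] at hx
      obtain ⟨h1, h2⟩ := hs s hsb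
      have hxs : x - s ≠ 0 := by linarith [hx.1]
      have d := (((((hasDerivAt_id s).const_sub x).rpow_const (p := c) (Or.inl hxs)).mul_const
        (x ^ a)).mul_const ((1 - x) ^ b)).const_mul (f.eval x)
      refine d.congr_deriv ?_
      simp only [genJacobiWeight, id]
      ring)
  have h := main.2
  rw [intervalIntegral.integral_const_mul] at h
  exact h

/-! ### Orthogonal polynomials of a semiclassical functional -/

/-- Synthetic division by `X - s`, with the degree and the coefficients at the top recorded. -/
theorem exists_eq_C_add_X_sub_C_mul (s : ℝ) {f : ℝ[X]} {k : ℕ} (hf : f.natDegree ≤ k + 1) :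
    ∃ g : ℝ[X], f = C (f.eval s) + (X - C s) * g ∧ g.natDegree ≤ k ∧
      g.coeff k = f.coeff (k + 1) := by
  have h := modByMonic_add_div f (X - C s)
  rw [modByMonic_X_sub_C_eq_C_eval] at h
  have hd : (f /ₘ (X - C s)).natDegree ≤ k := by
    rw [natDegree_divByMonic f (monic_X_sub_C s), natDegree_X_sub_C]; omega
  refine ⟨f /ₘ (X - C s), h.symm, hd, ?_⟩
  conv_rhs => rw [← h]
  rw [coeff_add, coeff_C_succ, zero_add, sub_mul, coeff_sub, coeff_X_mul, coeff_C_mul,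
    coeff_eq_zero_of_natDegree_lt (lt_of_le_of_lt hd (Nat.lt_succ_self k)), mul_zero, sub_zero]

/-- `P` is the monic orthogonal polynomial of degree `m + 1` for `L`, and `Q` is the polynomial of
degree at most `m` representing the coefficient functional `f ↦ f.coeff m`; it is a multiple of
the orthogonal polynomial of degree `m`. -/
structure IsOrthoPair (L : ℝ[X] →ₗ[ℝ] ℝ) (m : ℕ) (P Q : ℝ[X]) : Prop where
  natDegree_left : P.natDegree ≤ m + 1
  coeff_left : P.coeff (m + 1) = 1
  natDegree_right : Q.natDegree ≤ m
  left_mul : ∀ f : ℝ[X], f.natDegree ≤ m → L (P * f) = 0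
  right_mul : ∀ f : ℝ[X], f.natDegree ≤ m → L (Q * f) = f.coeff m

/-- `M` divides the functional `L` by `X - s`: formally `M f = L (f / (X - s))`. -/
def IsCauchyAt (L M : ℝ[X] →ₗ[ℝ] ℝ) (s : ℝ) : Prop :=
  ∀ f, M ((X - C s) * f) = L f

/-- Abstract form of `L f = ∫ f w` for a weight with `w'/w = α/x + β/(x-1) + γ/(x-t)` that vanishes
at the ends of its support; `L₀`, `L₁`, `Lₜ` are the divisions of `L` by `x`, `x - 1` and `x - t`. -/
structure IsPearson (α β γ t : ℝ) (L L₀ L₁ Lₜ : ℝ[X] →ₗ[ℝ] ℝ) : Prop where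
  zero : IsCauchyAt L L₀ 0
  one : IsCauchyAt L L₁ 1
  pole : IsCauchyAt L Lₜ t
  parts : ∀ f, L (derivative f) + α * L₀ f + β * L₁ f + γ * Lₜ f = 0

theorem map_C_mul (M : ℝ[X] →ₗ[ℝ] ℝ) (r : ℝ) (f : ℝ[X]) : M (C r * f) = r * M f := by
  rw [← smul_eq_C_mul, map_smul, smul_eq_mul]

theorem IsCauchyAt.X_mul {L M : ℝ[X] →ₗ[ℝ] ℝ} {s : ℝ} (h : IsCauchyAt L M s) (f : ℝ[X]) :
    M (X * f) = L f + s * M f := by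
  rw [← h f, sub_mul, map_sub, map_C_mul]; ring

/-- The Euler operator minus its top eigenvalue lowers the degree. -/
theorem natDegree_X_mul_derivative_sub_le {f : ℝ[X]} {k : ℕ} (hf : f.natDegree ≤ k + 1) :
    (X * derivative f - C ((k : ℝ) + 1) * f).natDegree ≤ k := by
  rw [natDegree_le_iff_coeff_eq_zero]
  intro j hj
  obtain ⟨i, rfl⟩ : ∃ i, j = i + 1 := ⟨j - 1, by omega⟩
  rw [coeff_sub, coeff_X_mul, coeff_derivative, coeff_C_mul]
  rcases Nat.lt_or_ge k i with hi | hi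
  · rw [coeff_eq_zero_of_natDegree_lt (lt_of_le_of_lt hf (by omega))]; ring
  · obtain rfl : i = k := by omega
    ring

theorem natDegree_X_mul_derivative_le {f : ℝ[X]} {k : ℕ} (hf : f.natDegree ≤ k) :
    (X * derivative f).natDegree ≤ k := by
  rw [natDegree_le_iff_coeff_eq_zero]
  intro j hj
  obtain ⟨i, rfl⟩ : ∃ i, j = i + 1 := ⟨j - 1, by omega⟩
  rw [coeff_X_mul, coeff_derivative, coeff_eq_zero_of_natDegree_lt (lt_of_le_of_lt hf hj), zero_mul]

theorem coeff_X_mul_derivative (f : ℝ[X]) (k : ℕ) :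
    (X * derivative f).coeff k = k * f.coeff k := by
  cases k with
  | zero => simp
  | succ k => rw [coeff_X_mul, coeff_derivative]; push_cast; ring

section Pair
variable {L : ℝ[X] →ₗ[ℝ] ℝ} {m : ℕ} {P Q : ℝ[X]} (h : IsOrthoPair L m P Q)
include h

theorem IsOrthoPair.coeff_right_succ : Q.coeff (m + 1) = 0 :=
  coeff_eq_zero_of_natDegree_lt (Nat.lt_succ_of_le h.natDegree_right)

section Cauchy
variable {M : ℝ[X] →ₗ[ℝ] ℝ} {s : ℝ} (hM : IsCauchyAt L M s)
include hM

theorem IsOrthoPair.cauchy_left_mul {f : ℝ[X]} (hf : f.natDegree ≤ m + 1) :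
    M (P * f) = f.eval s * M P := by
  obtain ⟨g, hg, hgd, -⟩ := exists_eq_C_add_X_sub_C_mul s hf
  conv_lhs => rw [hg]
  rw [show P * (C (f.eval s) + (X - C s) * g) = C (f.eval s) * P + (X - C s) * (P * g) by ring,
    map_add, map_C_mul, hM, h.left_mul g hgd, add_zero]

theorem IsOrthoPair.cauchy_right_mul {f : ℝ[X]} (hf : f.natDegree ≤ m + 1) :
    M (Q * f) = f.eval s * M Q + f.coeff (m + 1) := by
  obtain ⟨g, hg, hgd, hgc⟩ := exists_eq_C_add_X_sub_C_mul s hf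
  conv_lhs => rw [hg]
  rw [show Q * (C (f.eval s) + (X - C s) * g) = C (f.eval s) * Q + (X - C s) * (Q * g) by ring,
    map_add, map_C_mul, hM, h.right_mul g hgd, hgc]

theorem IsOrthoPair.cauchy_left_left : M (P * P) = P.eval s * M P :=
  h.cauchy_left_mul hM h.natDegree_left

theorem IsOrthoPair.cauchy_left_right : M (P * Q) = Q.eval s * M P :=
  h.cauchy_left_mul hM (h.natDegree_right.trans (Nat.le_succ m))

theorem IsOrthoPair.cauchy_right_right : M (Q * Q) = Q.eval s * M Q := by
  rw [h.cauchy_right_mul hM (h.natDegree_right.trans (Nat.le_succ m)),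
    h.coeff_right_succ, add_zero]

/-- The Wronskian identity for `P`, `Q` and their Cauchy transforms. -/
theorem IsOrthoPair.cauchy_wronskian : Q.eval s * M P = P.eval s * M Q + 1 := by
  rw [← h.cauchy_left_right hM, mul_comm, h.cauchy_right_mul hM h.natDegree_left, h.coeff_left]

/-- With `r = θ M(PQ)`, `R = θ M(PP)`, `S = θ M(QQ)`, the residue matrix of the Lax pair at `s`
has diagonal entries `±(r - θ/2)` and off-diagonal entries `R`, `-S`. The lemma says that its
determinant is `-θ²/4`. -/
theorem IsOrthoPair.cauchy_det (θ : ℝ) :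
    θ * M (P * Q) * (θ * M (P * Q) - θ) = θ * M (P * P) * (θ * M (Q * Q)) := by
  have w := h.cauchy_wronskian hM
  rw [h.cauchy_left_right hM, h.cauchy_left_left hM, h.cauchy_right_right hM]
  linear_combination θ ^ 2 * Q.eval s * M P * w

end Cauchy

theorem IsOrthoPair.left_mul_derivative_left : L (P * derivative P) = 0 :=
  h.left_mul _ ((natDegree_derivative_le P).trans (by have := h.natDegree_left; omega))

theorem IsOrthoPair.left_mul_derivative_right : L (P * derivative Q) = 0 :=
  h.left_mul _ ((natDegree_derivative_le Q).trans (by have := h.natDegree_right; omega))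

theorem IsOrthoPair.right_mul_derivative_left : L (Q * derivative P) = m + 1 := by
  rw [h.right_mul _ ((natDegree_derivative_le P).trans (by have := h.natDegree_left; omega)),
    coeff_derivative, h.coeff_left, one_mul]

theorem IsOrthoPair.right_mul_derivative_right : L (Q * derivative Q) = 0 := by
  rw [h.right_mul _ ((natDegree_derivative_le Q).trans (by have := h.natDegree_right; omega)),
    coeff_derivative, coeff_eq_zero_of_natDegree_lt (Nat.lt_succ_of_le h.natDegree_right), zero_mul]

theorem IsOrthoPair.left_mul_right : L (P * Q) = 0 := h.left_mul Q h.natDegree_right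

theorem IsOrthoPair.right_mul_right : L (Q * Q) = Q.coeff m := h.right_mul Q h.natDegree_right

theorem IsOrthoPair.left_mul_X_mul_derivative_left :
    L (P * (X * derivative P)) = (m + 1) * L (P * P) := by
  have := h.left_mul _ (natDegree_X_mul_derivative_sub_le h.natDegree_left)
  rw [mul_sub, map_sub, mul_left_comm P (C _) P, map_C_mul] at this
  linarith

theorem IsOrthoPair.right_mul_X_mul_derivative_left :
    L (Q * (X * derivative P)) = -P.coeff m := by
  have := h.right_mul _ (natDegree_X_mul_derivative_sub_le h.natDegree_left)
  rw [mul_sub, map_sub, mul_left_comm Q (C _) P, map_C_mul, mul_comm Q P, h.left_mul_right,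
    mul_zero, sub_zero, coeff_sub, coeff_C_mul] at this
  rw [this]
  cases m with
  | zero => simp
  | succ k => rw [coeff_X_mul, coeff_derivative]; push_cast; ring

theorem IsOrthoPair.left_mul_X_mul_derivative_right : L (P * (X * derivative Q)) = 0 :=
  h.left_mul _ (natDegree_X_mul_derivative_le h.natDegree_right)

theorem IsOrthoPair.right_mul_X_mul_derivative_right :
    L (Q * (X * derivative Q)) = m * L (Q * Q) := by
  rw [h.right_mul _ (natDegree_X_mul_derivative_le h.natDegree_right), h.right_mul_right,
    coeff_X_mul_derivative]

/-! ### Linear and quadratic relations between the residues -/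

section Pearson
variable {α β γ t : ℝ} {L₀ L₁ Lₜ : ℝ[X] →ₗ[ℝ] ℝ} (hL : IsPearson α β γ t L L₀ L₁ Lₜ)
include hL

/-- The three `sum` relations say that the residue matrices at `0`, `1` and `t` add up to a
diagonal matrix; they are the Pearson relation tested on `P²`, `PQ` and `Q²`. -/
theorem IsOrthoPair.sum_left_left :
    α * L₀ (P * P) + β * L₁ (P * P) + γ * Lₜ (P * P) = 0 := by
  have e := hL.parts (P * P)
  rw [derivative_mul, mul_comm (derivative P) P, map_add, h.left_mul_derivative_left] at e
  linarith

theorem IsOrthoPair.sum_left_right :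
    α * L₀ (P * Q) + β * L₁ (P * Q) + γ * Lₜ (P * Q) = -(m + 1) := by
  have e := hL.parts (P * Q)
  rw [derivative_mul, mul_comm (derivative P) Q, map_add, h.left_mul_derivative_right,
    h.right_mul_derivative_left] at e
  linarith

theorem IsOrthoPair.sum_right_right :
    α * L₀ (Q * Q) + β * L₁ (Q * Q) + γ * Lₜ (Q * Q) = 0 := by
  have e := hL.parts (Q * Q)
  rw [derivative_mul, mul_comm (derivative Q) Q, map_add, h.right_mul_derivative_right] at e
  linarith

omit h in
theorem IsPearson.parts_X_mul (f g : ℝ[X]) :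
    L (f * g) + L (g * (X * derivative f)) + L (f * (X * derivative g))
      + (α + β + γ) * L (f * g) + β * L₁ (f * g) + t * (γ * Lₜ (f * g)) = 0 := by
  have e := hL.parts (X * (f * g))
  rw [hL.zero.X_mul, hL.one.X_mul, hL.pole.X_mul, derivative_mul, derivative_X, derivative_mul,
    one_mul, show X * (derivative f * g + f * derivative g)
      = g * (X * derivative f) + f * (X * derivative g) by ring, map_add, map_add] at e
  linarith

omit h in
/-- The Pearson relation tested on `X (X - 1) X ^ k`. When `L` depends on `t` with
`dL/dt = -γ Lₜ`, this gives the derivatives of the moments in terms of the moments. -/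
theorem IsPearson.mul_pole_X_pow (k : ℕ) :
    t * (t - 1) * (-γ * Lₜ (X ^ k)) = (k + (2 + α + β + γ)) * L (X ^ (k + 1))
      - (k + (1 + α + γ - γ * t)) * L (X ^ k) := by
  have e := hL.parts (X * ((X - C 1) * X ^ k))
  have ed : derivative (X * ((X - C 1) * X ^ k) : ℝ[X])
      = C ((k : ℝ) + 2) * X ^ (k + 1) - C ((k : ℝ) + 1) * X ^ k := by
    rw [show (X * ((X - C 1) * X ^ k) : ℝ[X]) = X ^ (k + 2) - X ^ (k + 1) by rw [C_1]; ring,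
      derivative_sub, derivative_X_pow, derivative_X_pow]
    push_cast
    rfl
  have eg : ((X - C 1) * X ^ k : ℝ[X]) = X * X ^ k - X ^ k := by rw [C_1]; ring
  rw [hL.zero.X_mul, hL.one.X_mul, hL.pole.X_mul, hL.one, ed, eg] at e
  simp only [map_sub, map_C_mul, hL.pole.X_mul] at e
  rw [← pow_succ'] at e
  linear_combination (-1 : ℝ) * e

/-- The three `moment` relations are the Pearson relation tested on `XP²`, `XPQ` and `XQ²`. -/
theorem IsOrthoPair.moment_left_left :
    β * L₁ (P * P) + t * (γ * Lₜ (P * P)) = -(2 * (m + 1) + α + β + γ + 1) * L (P * P) := by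
  have e := hL.parts_X_mul P P
  rw [h.left_mul_X_mul_derivative_left] at e
  linarith

theorem IsOrthoPair.moment_left_right :
    β * L₁ (P * Q) + t * (γ * Lₜ (P * Q)) = P.coeff m := by
  have e := hL.parts_X_mul P Q
  rw [h.right_mul_X_mul_derivative_left, h.left_mul_X_mul_derivative_right, h.left_mul_right] at e
  linarith

theorem IsOrthoPair.moment_right_right :
    β * L₁ (Q * Q) + t * (γ * Lₜ (Q * Q)) = -(2 * (m + 1) + α + β + γ - 1) * L (Q * Q) := by
  have e := hL.parts_X_mul Q Q
  rw [h.right_mul_X_mul_derivative_right] at e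
  linarith

/-- The commutator term `α γ (L₀(PP) Lₜ(QQ) - Lₜ(PP) L₀(QQ))` of the Schlesinger equation satisfies,
because the three residue matrices have prescribed determinants and a diagonal sum, a relation
involving only `p = P.coeff m` and `r = γ Lₜ(PQ)`; `r0` and `r1` are the diagonal residues
`α L₀(PQ)` and `β L₁(PQ)` in terms of these. -/
theorem IsOrthoPair.commutator_sq {r p r0 r1 : ℝ} (hp : p = P.coeff m) (hr : r = γ * Lₜ (P * Q))
    (h1 : r1 = p - t * r) (h0 : r0 = -(m + 1) - r1 - r) {V : ℝ}
    (hV : V = r1 * (r1 - β) - t ^ 2 * (r * (r - γ)) - r0 * (r0 - α)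
      + (t - 1) ^ 2 * (r * (r - γ))) :
    (α * L₀ (P * P) * (γ * Lₜ (Q * Q)) - γ * Lₜ (P * P) * (α * L₀ (Q * Q))) ^ 2 =
      V ^ 2 - 4 * (r1 * (r1 - β) - t ^ 2 * (r * (r - γ)) - t * V) * (r * (r - γ)) := by
  have d0 := h.cauchy_det hL.zero α
  have d1 := h.cauchy_det hL.one β
  have dt := h.cauchy_det hL.pole γ
  have a1 := h.sum_left_left hL
  have a2 := h.sum_left_right hL
  have a3 := h.sum_right_right hL
  have b1 := h.moment_left_left hL
  have b2 := h.moment_left_right hL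
  have b3 := h.moment_right_right hL
  have e1 : β * L₁ (P * Q) = r1 := by rw [h1, hp, hr]; linarith
  have e0 : α * L₀ (P * Q) = r0 := by rw [h0, ← e1, hr]; linarith
  rw [e0] at d0
  rw [e1] at d1
  rw [← hr] at dt
  generalize α * L₀ (P * P) = R0 at *
  generalize β * L₁ (P * P) = R1 at *
  generalize γ * Lₜ (P * P) = Rt at *
  generalize α * L₀ (Q * Q) = S0 at *
  generalize β * L₁ (Q * Q) = S1 at *
  generalize γ * Lₜ (Q * Q) = St at *
  generalize -(2 * (m + 1 : ℝ) + α + β + γ + 1) * L (P * P) = x at *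
  generalize -(2 * (m + 1 : ℝ) + α + β + γ - 1) * L (Q * Q) = y at *
  -- In terms of `x`, `y`, `Rt`, `St` the commutator is `±(x * St - y * Rt)`, whose square is
  -- `(x * St + y * Rt) ^ 2 - 4 * (x * y) * (Rt * St)`; `d0` and `d1` determine `x * St + y * Rt`
  -- and `x * y`, and `dt` determines `Rt * St`.
  obtain rfl : R1 = x - t * Rt := by linarith
  obtain rfl : S1 = y - t * St := by linarith
  obtain rfl : R0 = -x + (t - 1) * Rt := by linarith
  obtain rfl : S0 = -y + (t - 1) * St := by linarith
  rw [d1, d0, dt] at hV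
  rw [d1, dt]
  have hV' : V = -(x * St + y * Rt) := by rw [hV]; ring
  rw [hV']
  ring

end Pearson

/-! ### Deformation equations -/

/-- A diagonal residue at `t` is the derivative of the subleading coefficient of `P`, for `P'`
obeying the equations satisfied by the derivative of `P` in `t`. -/
theorem IsOrthoPair.coeff_deformation {M : ℝ[X] →ₗ[ℝ] ℝ} {γ : ℝ} {P' : ℝ[X]} (hP : P'.natDegree ≤ m)
    (hP' : ∀ f : ℝ[X], f.natDegree ≤ m → L (P' * f) = γ * M (P * f)) :
    P'.coeff m = γ * M (P * Q) := by
  rw [← h.right_mul P' hP, mul_comm, hP' Q h.natDegree_right]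

section Deformation
variable {t : ℝ} {M : ℝ[X] →ₗ[ℝ] ℝ} (hM : IsCauchyAt L M t)
  (hpos : ∀ f, f ≠ 0 → 0 < L (f * f))
include hM hpos

/-- If `G` represents `f ↦ κ f(t)` on polynomials of degree at most `m`, then `G` is `κ` times the
Christoffel-Darboux kernel at `t`. -/
theorem IsOrthoPair.X_sub_C_mul_eq_of_represents {G : ℝ[X]} {κ : ℝ} (hG : G.natDegree ≤ m)
    (hGf : ∀ f : ℝ[X], f.natDegree ≤ m → L (G * f) = κ * f.eval t) :
    (X - C t) * G = C κ * (C (Q.eval t) * P - C (P.eval t) * Q) := by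
  set D := C (Q.eval t) * P - C (P.eval t) * Q with hD
  have hDd : D.natDegree ≤ m + 1 :=
    (natDegree_sub_le _ _).trans (max_le ((natDegree_C_mul_le _ _).trans h.natDegree_left)
      ((natDegree_C_mul_le _ _).trans (h.natDegree_right.trans (Nat.le_succ m))))
  obtain ⟨K, hK, hKd, -⟩ := exists_eq_C_add_X_sub_C_mul t hDd
  have hD0 : D.eval t = 0 := by simp only [hD, eval_sub, eval_mul, eval_C]; ring
  rw [hD0, C_0, zero_add] at hK
  have hK1 : L K = 1 := by
    rw [← hM K, ← hK, hD, map_sub, map_C_mul, map_C_mul, h.cauchy_wronskian hM]; ring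
  have hKf : ∀ f : ℝ[X], f.natDegree ≤ m → L (K * f) = f.eval t := fun f hf => by
    obtain ⟨g, hg, hgd, hgc⟩ := exists_eq_C_add_X_sub_C_mul t (hf.trans (Nat.le_succ m))
    have e : K * f = C (f.eval t) * K
        + (C (Q.eval t) * (P * g) - C (P.eval t) * (Q * g)) := by
      conv_lhs => rw [hg]
      linear_combination (-g) * hK + g * hD
    rw [e, map_add, map_C_mul, hK1, map_sub, map_C_mul, map_C_mul, h.left_mul g hgd,
      h.right_mul g hgd, hgc, coeff_eq_zero_of_natDegree_lt (Nat.lt_succ_of_le hf)]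
    ring
  have hz : G - C κ * K = 0 := by
    by_contra hne
    have hd : (G - C κ * K).natDegree ≤ m :=
      (natDegree_sub_le _ _).trans (max_le hG ((natDegree_C_mul_le _ _).trans hKd))
    have := hpos _ hne
    rw [sub_mul, mul_assoc, map_sub, map_C_mul, hGf _ hd, hKf _ hd, sub_self] at this
    exact lt_irrefl 0 this
  rw [sub_eq_zero.1 hz, hK]; ring

/-- The Schlesinger equation for the diagonal entry of the residue matrix at `s`, for polynomials
`P'`, `Q'` obeying the equations satisfied by the derivatives of `P` and `Q` in `t`. -/
theorem IsOrthoPair.schlesinger {γ s θ : ℝ} {N : ℝ[X] →ₗ[ℝ] ℝ} (hN : IsCauchyAt L N s)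
    {P' Q' : ℝ[X]} (hP : P'.natDegree ≤ m) (hQ : Q'.natDegree ≤ m)
    (hP' : ∀ f : ℝ[X], f.natDegree ≤ m → L (P' * f) = γ * M (P * f))
    (hQ' : ∀ f : ℝ[X], f.natDegree ≤ m → L (Q' * f) = γ * M (Q * f)) :
    (s - t) * (θ * N (P' * Q + P * Q')) + θ * γ * (M (P * Q) - N (P * Q)) =
      θ * N (P * P) * (γ * M (Q * Q)) - γ * M (P * P) * (θ * N (Q * Q)) := by
  have rep : ∀ f : ℝ[X], f.natDegree ≤ m →
      M (P * f) = f.eval t * M P ∧ M (Q * f) = f.eval t * M Q := fun f hf =>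
    ⟨h.cauchy_left_mul hM (hf.trans (Nat.le_succ m)), by
      rw [h.cauchy_right_mul hM (hf.trans (Nat.le_succ m)),
        coeff_eq_zero_of_natDegree_lt (Nat.lt_succ_of_le hf), add_zero]⟩
  have kP := congrArg (eval s) (h.X_sub_C_mul_eq_of_represents hM hpos hP (κ := γ * M P)
    fun f hf => by rw [hP' f hf, (rep f hf).1]; ring)
  have kQ := congrArg (eval s) (h.X_sub_C_mul_eq_of_represents hM hpos hQ (κ := γ * M Q)
    fun f hf => by rw [hQ' f hf, (rep f hf).2]; ring)
  simp only [eval_mul, eval_sub, eval_X, eval_C] at kP kQ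
  have w := h.cauchy_wronskian hM
  have v := h.cauchy_wronskian hN
  rw [map_add, mul_comm P' Q, h.cauchy_right_mul hN (hP.trans (Nat.le_succ m)),
    h.cauchy_left_mul hN (hQ.trans (Nat.le_succ m)),
    coeff_eq_zero_of_natDegree_lt (Nat.lt_succ_of_le hP), add_zero,
    h.cauchy_left_right hM, h.cauchy_left_right hN, h.cauchy_left_left hM, h.cauchy_left_left hN,
    h.cauchy_right_right hM, h.cauchy_right_right hN]
  linear_combination θ * N Q * kP + θ * N P * kQ
    + θ * γ * (Q.eval s * N P * w - Q.eval t * M P * v)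

end Deformation
end Pair

/-! ### Differentiation of determinants and inverses -/

section MatrixCalculus
open Matrix
variable {ι : Type*} [Fintype ι] [DecidableEq ι] {A : ℝ → Matrix ι ι ℝ} {A' : Matrix ι ι ℝ} {t : ℝ}

/-- Jacobi's formula for the derivative of a determinant. -/
theorem hasDerivAt_det (hA : ∀ i j, HasDerivAt (fun s => A s i j) (A' i j) t) :
    HasDerivAt (fun s => (A s).det) ((A t).adjugate * A').trace t := by
  have h : HasDerivAt (fun s => (A s).det) (∑ σ : Equiv.Perm ι, ((Equiv.Perm.sign σ : ℤ) : ℝ) *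
      ∑ i, (∏ j ∈ Finset.univ.erase i, A t (σ j) j) • A' (σ i) i) t := by
    simp only [det_apply']
    exact HasDerivAt.fun_sum fun σ _ =>
      (HasDerivAt.fun_finsetProd fun i _ => hA (σ i) i).const_mul _
  refine h.congr_deriv ?_
  have e : ((A t).adjugate * A').trace = ∑ i, ((A t).updateCol i fun j => A' j i).det := by
    refine Finset.sum_congr rfl fun i _ => ?_
    rw [← cramer_apply, cramer_eq_adjugate_mulVec]
    rfl
  rw [e]
  simp only [det_apply', Finset.mul_sum]
  rw [Finset.sum_comm]
  refine Finset.sum_congr rfl fun i _ => Finset.sum_congr rfl fun σ _ => ?_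
  rw [← Finset.mul_prod_erase Finset.univ _ (Finset.mem_univ i), updateCol_self, smul_eq_mul,
    mul_comm (∏ j ∈ _, _)]
  congr 2
  refine Finset.prod_congr rfl fun j hj => ?_
  rw [updateCol_ne (Finset.ne_of_mem_erase hj)]

theorem differentiableAt_det (hA : ∀ i j, DifferentiableAt ℝ (fun s => A s i j) t) :
    DifferentiableAt ℝ (fun s => (A s).det) t :=
  (hasDerivAt_det (A' := of fun i j => deriv (fun s => A s i j) t)
    fun i j => (hA i j).hasDerivAt).differentiableAt

theorem differentiableAt_inv_apply (hA : ∀ i j, DifferentiableAt ℝ (fun s => A s i j) t)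
    (h0 : (A t).det ≠ 0) (i j : ι) : DifferentiableAt ℝ (fun s => (A s)⁻¹ i j) t := by
  have e : (fun s => (A s)⁻¹ i j) = fun s =>
      (A s).det⁻¹ * ((A s).updateRow j (Pi.single i 1)).det := by
    ext s
    rw [inv_def, Ring.inverse_eq_inv', Matrix.smul_apply, smul_eq_mul, adjugate_apply]
  rw [e]
  refine ((differentiableAt_det hA).inv h0).mul (differentiableAt_det fun k l => ?_)
  by_cases hk : k = j
  · subst hk; simp
  · simpa [updateRow_ne hk] using hA k l

end MatrixCalculus

/-! ### Hankel matrices and the orthogonal pair -/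

section Hankel
open Matrix

/-- The Hankel matrix of size `m + 1` of the moments `F (X ^ k)`. -/
def hankelMatrix (F : ℝ[X] → ℝ) (m : ℕ) : Matrix (Fin (m + 1)) (Fin (m + 1)) ℝ :=
  of fun j k => F (X ^ ((j : ℕ) + (k : ℕ)))

/-- The coefficients of the orthogonal projection of `X ^ (m + 1)` to degree at most `m`. -/
def projCoeff (F : ℝ[X] → ℝ) (m : ℕ) : Fin (m + 1) → ℝ :=
  (hankelMatrix F m)⁻¹ *ᵥ fun j => F (X ^ ((j : ℕ) + (m + 1)))

/-- The monic orthogonal polynomial of degree `m + 1`. -/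
def orthoLeft (F : ℝ[X] → ℝ) (m : ℕ) : ℝ[X] := X ^ (m + 1) - ofFn (m + 1) (projCoeff F m)

/-- The polynomial of degree at most `m` dual to `X ^ m` with respect to `1, X, …, X ^ m`. -/
def orthoRight (F : ℝ[X] → ℝ) (m : ℕ) : ℝ[X] :=
  ofFn (m + 1) fun j => (hankelMatrix F m)⁻¹ j (Fin.last m)

theorem natDegree_ofFn_succ_le (m : ℕ) (v : Fin (m + 1) → ℝ) : (ofFn (m + 1) v).natDegree ≤ m :=
  Nat.lt_succ_iff.1 (ofFn_natDegree_lt (Nat.succ_pos m) v)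

theorem natDegree_orthoLeft_le (F : ℝ[X] → ℝ) (m : ℕ) : (orthoLeft F m).natDegree ≤ m + 1 :=
  (natDegree_sub_le _ _).trans (max_le (natDegree_X_pow_le _)
    ((natDegree_ofFn_succ_le m _).trans (Nat.le_succ m)))

theorem natDegree_orthoRight_le (F : ℝ[X] → ℝ) (m : ℕ) : (orthoRight F m).natDegree ≤ m :=
  natDegree_ofFn_succ_le m _

theorem coeff_orthoLeft_last (F : ℝ[X] → ℝ) (m : ℕ) :
    (orthoLeft F m).coeff m = -projCoeff F m (Fin.last m) := by
  rw [orthoLeft, coeff_sub, coeff_X_pow, if_neg (by omega),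
    ofFn_coeff_eq_val_of_lt _ (Nat.lt_succ_self m), zero_sub]
  rfl

theorem coeff_orthoLeft_succ (F : ℝ[X] → ℝ) (m : ℕ) : (orthoLeft F m).coeff (m + 1) = 1 := by
  rw [orthoLeft, coeff_sub, coeff_X_pow, if_pos rfl, ofFn_coeff_eq_zero_of_ge _ le_rfl, sub_zero]

variable {L : ℝ[X] →ₗ[ℝ] ℝ} {m : ℕ}

theorem map_mul_eq_sum_range {M : ℝ[X] →ₗ[ℝ] ℝ} (g : ℝ[X]) {f : ℝ[X]} {d : ℕ}
    (hf : f.natDegree ≤ d) :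
    M (g * f) = ∑ k ∈ Finset.range (d + 1), f.coeff k * M (g * X ^ k) := by
  conv_lhs => rw [as_sum_range_C_mul_X_pow' f (Nat.lt_succ_of_le hf), Finset.mul_sum, map_sum]
  refine Finset.sum_congr rfl fun k _ => ?_
  rw [mul_left_comm, map_C_mul]

theorem map_ofFn_mul_X_pow (v : Fin (m + 1) → ℝ) (k : ℕ) :
    L (ofFn (m + 1) v * X ^ k) = ∑ j, v j * L (X ^ ((j : ℕ) + k)) := by
  rw [ofFn_eq_sum_monomial, Finset.sum_mul, map_sum]
  refine Finset.sum_congr rfl fun j _ => ?_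
  rw [← C_mul_X_pow_eq_monomial, mul_assoc, ← pow_add, map_C_mul]

theorem hankelMatrix_transpose (F : ℝ[X] → ℝ) (m : ℕ) :
    (hankelMatrix F m)ᵀ = hankelMatrix F m := by
  ext j k
  simp only [transpose_apply, hankelMatrix, of_apply, add_comm]

theorem map_ofFn_mul_X_pow_fin (v : Fin (m + 1) → ℝ) (k : Fin (m + 1)) :
    L (ofFn (m + 1) v * X ^ (k : ℕ)) = (hankelMatrix L m *ᵥ v) k := by
  rw [map_ofFn_mul_X_pow]
  refine Finset.sum_congr rfl fun j _ => ?_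
  rw [mul_comm, add_comm]; rfl

theorem det_hankelMatrix_pos (hpos : ∀ f, f ≠ 0 → 0 < L (f * f)) :
    0 < (hankelMatrix L m).det := by
  refine PosDef.det_pos (PosDef.of_dotProduct_mulVec_pos ?_ fun v hv => ?_)
  · rw [IsHermitian, conjTranspose_eq_transpose_of_trivial, hankelMatrix_transpose]
  · have h := hpos (ofFn (m + 1) v) fun h0 => hv (injective_ofFn (m + 1) (by rw [h0, map_zero]))
    have e : L (ofFn (m + 1) v * ofFn (m + 1) v) = star v ⬝ᵥ (hankelMatrix L m *ᵥ v) := by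
      rw [map_mul_eq_sum_range _ (natDegree_ofFn_succ_le m v), Finset.sum_range]
      refine Finset.sum_congr rfl fun k _ => ?_
      rw [map_ofFn_mul_X_pow_fin, ofFn_coeff_eq_val_of_lt _ k.2]; rfl
    rwa [← e]

theorem isOrthoPair_ortho (hdet : (hankelMatrix L m).det ≠ 0) :
    IsOrthoPair L m (orthoLeft L m) (orthoRight L m) where
  natDegree_left := natDegree_orthoLeft_le L m
  coeff_left := coeff_orthoLeft_succ L m
  natDegree_right := natDegree_orthoRight_le L m
  left_mul f hf := by
    rw [map_mul_eq_sum_range _ hf, Finset.sum_range]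
    refine Finset.sum_eq_zero fun k _ => ?_
    rw [orthoLeft, sub_mul, map_sub, map_ofFn_mul_X_pow_fin, projCoeff, mulVec_mulVec,
      mul_nonsing_inv _ (isUnit_iff_ne_zero.2 hdet), one_mulVec, ← pow_add, add_comm (m + 1),
      sub_self, mul_zero]
  right_mul f hf := by
    have key : ∀ k : Fin (m + 1), L (orthoRight L m * X ^ (k : ℕ))
        = if k = Fin.last m then 1 else 0 :=
      fun k => by
        rw [orthoRight, map_ofFn_mul_X_pow_fin]
        have := congrFun (congrFun (mul_nonsing_inv (hankelMatrix L m)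
          (isUnit_iff_ne_zero.2 hdet)) k) (Fin.last m)
        rw [one_apply] at this
        exact this
    rw [map_mul_eq_sum_range _ hf, Finset.sum_range]
    simp only [key, mul_ite, mul_one, mul_zero]
    rw [Finset.sum_ite_eq' Finset.univ (Fin.last m)]
    simp

/-- A weighted trace of Hankel matrices, computed because multiplication by `X` acts on
polynomials of degree at most `m`, modulo the orthogonal polynomial, by a companion matrix. -/
theorem trace_inv_hankelMatrix_mul (F : ℝ[X] → ℝ) (m : ℕ) (hdet : (hankelMatrix F m).det ≠ 0)
    (c d : ℝ) :
    ((hankelMatrix F m)⁻¹ * of fun j k : Fin (m + 1) =>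
        ((j : ℝ) + (k : ℝ) + c) * F (X ^ ((j : ℕ) + (k : ℕ) + 1))
          - ((j : ℝ) + (k : ℝ) + d) * F (X ^ ((j : ℕ) + (k : ℕ)))).trace
      = -(2 * m + c) * (orthoLeft F m).coeff m - (m + 1) * (m + d) := by
  have hu := isUnit_iff_ne_zero.2 hdet
  have hsymm := hankelMatrix_transpose F m
  have hproj : ∑ j, (hankelMatrix F m)⁻¹ (Fin.last m) j * F (X ^ ((j : ℕ) + (m + 1)))
      = -(orthoLeft F m).coeff m := by rw [coeff_orthoLeft_last, neg_neg]; rfl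
  generalize (orthoLeft F m).coeff m = p at *
  set H := hankelMatrix F m with hH
  set H1 : Matrix (Fin (m + 1)) (Fin (m + 1)) ℝ :=
    of fun j k => F (X ^ ((j : ℕ) + (k : ℕ) + 1)) with hH1
  set N : Matrix (Fin (m + 1)) (Fin (m + 1)) ℝ := diagonal fun j => (j : ℝ) with hN
  have h1 : (of fun j k : Fin (m + 1) =>
        ((j : ℝ) + (k : ℝ) + c) * F (X ^ ((j : ℕ) + (k : ℕ) + 1))
          - ((j : ℝ) + (k : ℝ) + d) * F (X ^ ((j : ℕ) + (k : ℕ))))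
      = N * H1 + H1 * N + c • H1 - (N * H + H * N + d • H) := by
    ext j k
    simp only [hN, hH, hH1, hankelMatrix, Matrix.sub_apply, Matrix.add_apply, Matrix.smul_apply,
      diagonal_mul, mul_diagonal, of_apply, smul_eq_mul]
    ring
  have hdiag : ∀ k : Fin (m + 1), (H⁻¹ * H1) k k = if k = Fin.last m then -p else 0 := fun k => by
    rw [mul_apply]
    split_ifs with hk
    · rw [← hproj, hk]
      refine Finset.sum_congr rfl fun j _ => ?_
      simp only [hH1, of_apply, Fin.val_last, add_assoc]
    · have hlt : (k : ℕ) + 1 < m + 1 := by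
        have := Fin.val_lt_last hk; omega
      have e := congrFun (congrFun (nonsing_inv_mul H hu) k) ⟨k + 1, hlt⟩
      rw [one_apply, if_neg (by intro h; have := congrArg Fin.val h; simp at this), mul_apply] at e
      rw [← e]
      refine Finset.sum_congr rfl fun j _ => ?_
      simp only [hH1, hH, hankelMatrix, of_apply, add_assoc]
  have t1 : (H⁻¹ * H1).trace = -p := by
    simp only [trace, diag_apply, hdiag, Finset.sum_ite_eq', Finset.mem_univ, if_true]
  have t2 : (H⁻¹ * (H1 * N)).trace = m * -p := by
    rw [← Matrix.mul_assoc]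
    simp only [trace, diag_apply, hN, mul_diagonal, hdiag, ite_mul, zero_mul, Finset.sum_ite_eq',
      Finset.mem_univ, if_true, Fin.val_last]
    ring
  have t3 : (H⁻¹ * (N * H1)).trace = m * -p := by
    rw [← trace_transpose, transpose_mul, transpose_mul, transpose_nonsing_inv, hsymm,
      show H1ᵀ = H1 by ext j k; simp only [hH1, transpose_apply, of_apply, add_comm],
      show Nᵀ = N from diagonal_transpose _, trace_mul_comm, t2]
  have tN : N.trace = m * (m + 1) / 2 := by
    simp only [hN, trace_diagonal]
    rw [Fin.sum_univ_eq_sum_range (fun j => (j : ℝ)) (m + 1)]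
    have := Finset.sum_range_id_mul_two (m + 1)
    have h2 : ((∑ i ∈ Finset.range (m + 1), i : ℕ) : ℝ) * 2 = (m + 1) * m := by
      exact_mod_cast this
    push_cast at h2
    linarith
  have t4 : (H⁻¹ * (N * H)).trace = N.trace := by
    rw [trace_mul_comm, Matrix.mul_assoc, mul_nonsing_inv _ hu, Matrix.mul_one]
  have t5 : (H⁻¹ * (H * N)).trace = N.trace := by
    rw [← Matrix.mul_assoc, nonsing_inv_mul _ hu, Matrix.one_mul]
  have t6 : (H⁻¹ * H).trace = m + 1 := by
    rw [nonsing_inv_mul _ hu, trace_one, Fintype.card_fin]; push_cast; ring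
  rw [h1, Matrix.mul_sub, Matrix.mul_add, Matrix.mul_add, Matrix.mul_add, Matrix.mul_add,
    trace_sub, trace_add, trace_add, trace_add, trace_add, mul_smul_comm, mul_smul_comm,
    trace_smul, trace_smul, t1, t2, t3, t4, t5, t6, tN, smul_eq_mul, smul_eq_mul]
  ring

end Hankel

/-! ### Differentiable curves of polynomials -/

section CoeffDeriv

/-- A curve of polynomials is differentiable at `t`, coefficient by coefficient. -/
def HasCoeffDerivAt (F : ℝ → ℝ[X]) (F' : ℝ[X]) (t : ℝ) : Prop :=
  ∀ k, HasDerivAt (fun s => (F s).coeff k) (F'.coeff k) t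

variable {F G : ℝ → ℝ[X]} {F' G' : ℝ[X]} {t : ℝ}

theorem hasCoeffDerivAt_const (f : ℝ[X]) (t : ℝ) : HasCoeffDerivAt (fun _ => f) 0 t := fun k => by
  simpa using hasDerivAt_const t (f.coeff k)

theorem HasCoeffDerivAt.mul (hF : HasCoeffDerivAt F F' t) (hG : HasCoeffDerivAt G G' t) :
    HasCoeffDerivAt (fun s => F s * G s) (F' * G t + F t * G') t := fun k => by
  simp only [coeff_add, coeff_mul, ← Finset.sum_add_distrib]
  exact HasDerivAt.fun_sum fun ij _ => (hF ij.1).mul (hG ij.2)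

theorem HasCoeffDerivAt.natDegree_le (hF : HasCoeffDerivAt F F' t) {d : ℕ}
    (hd : ∀ s, (F s).natDegree ≤ d) : F'.natDegree ≤ d := by
  rw [natDegree_le_iff_coeff_eq_zero]
  intro k hk
  refine (hF k).unique ?_
  simp only [coeff_eq_zero_of_natDegree_lt (lt_of_le_of_lt (hd _) hk)]
  exact hasDerivAt_const t 0

theorem hasCoeffDerivAt_ofFn {m : ℕ} {v : ℝ → Fin m → ℝ}
    (hv : ∀ j, DifferentiableAt ℝ (fun s => v s j) t) :
    HasCoeffDerivAt (fun s => ofFn m (v s)) (ofFn m fun j => deriv (fun s => v s j) t) t :=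
  fun k => by
    rcases Nat.lt_or_ge k m with hk | hk
    · simp only [ofFn_coeff_eq_val_of_lt _ hk]
      exact (hv _).hasDerivAt
    · simp only [ofFn_coeff_eq_zero_of_ge _ hk]
      exact hasDerivAt_const t 0

theorem HasCoeffDerivAt.const_sub (hF : HasCoeffDerivAt F F' t) (f : ℝ[X]) :
    HasCoeffDerivAt (fun s => f - F s) (-F') t := fun k => by
  simp only [coeff_sub, coeff_neg]
  exact (hF k).const_sub _

theorem jacobiInt_eq_sum {a b c : ℝ} (ha : -1 < a) (hb : -1 < b) (ht : t < 0) {f : ℝ[X]} {d : ℕ}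
    (hf : f.natDegree ≤ d) :
    jacobiInt a b c t f = ∑ k ∈ Finset.range (d + 1), f.coeff k * jacobiInt a b c t (X ^ k) := by
  simpa [jacobiFunctional] using
    map_mul_eq_sum_range (M := jacobiFunctional (c := c) ha hb ht) 1 hf

theorem HasCoeffDerivAt.comp_jacobiInt {a b c : ℝ} (ha : -1 < a) (hb : -1 < b) (ht : t < 0)
    (hF : HasCoeffDerivAt F F' t) {d : ℕ} (hd : ∀ s, (F s).natDegree ≤ d) :
    HasDerivAt (fun s => jacobiInt a b c s (F s))
      (jacobiInt a b c t F' - c * jacobiInt a b (c - 1) t (F t)) t := by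
  have h : HasDerivAt
      (fun s => ∑ k ∈ Finset.range (d + 1), (F s).coeff k * jacobiInt a b c s (X ^ k))
      (∑ k ∈ Finset.range (d + 1), (F'.coeff k * jacobiInt a b c t (X ^ k)
        + (F t).coeff k * (-c * jacobiInt a b (c - 1) t (X ^ k)))) t :=
    HasDerivAt.fun_sum fun k _ => (hF k).mul (hasDerivAt_jacobiInt c ha hb ht (X ^ k))
  refine (h.congr_deriv ?_).congr_of_eventuallyEq ?_
  · rw [jacobiInt_eq_sum ha hb ht (hF.natDegree_le hd), jacobiInt_eq_sum ha hb ht (hd t),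
      Finset.mul_sum, ← Finset.sum_sub_distrib]
    exact Finset.sum_congr rfl fun k _ => by ring
  · filter_upwards [Iio_mem_nhds ht] with s hs
    exact jacobiInt_eq_sum ha hb hs (hd s)

end CoeffDeriv

/-! ### Elimination -/

/-- The elimination producing the `σ`-form. Here `p` is the subleading coefficient, `r`, `r0`, `r1`
are diagonal residues and `W` is the commutator, known through its square; `σ` and `σ'` are affine
in `p` and `r`, and `t (t - 1) σ'' = -N W`. -/
theorem sigma_form_of_lax_invariants {n α β γ t p r W V B r0 r1 σ σ' N : ℝ}
    (hN : N = 2 * n + α + β + γ)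
    (h1 : r1 = p - t * r) (h0 : r0 = -n - r1 - r)
    (hV : V = r1 * (r1 - β) - t ^ 2 * (r * (r - γ)) - r0 * (r0 - α) + (t - 1) ^ 2 * (r * (r - γ)))
    (hB : B = r1 * (r1 - β) - t ^ 2 * (r * (r - γ)) - t * V)
    (hW : W ^ 2 = V ^ 2 - 4 * B * (r * (r - γ)))
    (hσ : σ = -N * p + n * γ * t - n * (n + α + γ) + (-(n * (n + α + β + γ)) - (α + β) ^ 2 / 4) * t
      + (1 / 4) * (2 * n * (n + α + β + γ) + β * (α + β) - γ * (α - β)))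
    (hσ' : σ' = -N * r + n * γ + (-(n * (n + α + β + γ)) - (α + β) ^ 2 / 4)) :
    σ' * (-N * W) ^ 2 + (2 * σ' * (t * σ' - σ) - σ' ^ 2 - (α + β) / 2 * ((β - α) / 2) *
      ((2 * n + α + β) / 2) * ((2 * n + α + β + 2 * γ) / 2)) ^ 2 =
      (σ' + ((α + β) / 2) ^ 2) * (σ' + ((β - α) / 2) ^ 2) *
      (σ' + ((2 * n + α + β) / 2) ^ 2) * (σ' + ((2 * n + α + β + 2 * γ) / 2) ^ 2) := by
  have : σ' * (-N * W) ^ 2 = σ' * N ^ 2 * (V ^ 2 - 4 * B * (r * (r - γ))) := by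
    rw [← hW]; ring
  rw [this]
  subst hσ hσ' hB hV h0 h1 hN
  ring

/-! ### The generalized Jacobi weight -/

theorem hankelD_eq_det (α β γ s : ℝ) (m : ℕ) :
    hankelD (m + 1) α β γ s = (hankelMatrix (jacobiInt α β γ s) m).det := by
  simp only [hankelD, hankelMatrix, genJacobiMoment, jacobiInt, eval_pow, eval_X]

section Jacobi
variable {α β γ t : ℝ}

theorem isPearson_jacobi (hα : 0 < α) (hβ : 0 < β) (ht : t < 0) :
    IsPearson α β γ t
      (jacobiFunctional (c := γ) (by linarith : -1 < α) (by linarith : -1 < β) ht)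
      (jacobiFunctional (c := γ) (by linarith : -1 < α - 1) (by linarith : -1 < β) ht)
      (-jacobiFunctional (c := γ) (by linarith : -1 < α) (by linarith : -1 < β - 1) ht)
      (jacobiFunctional (c := γ - 1) (by linarith : -1 < α) (by linarith : -1 < β) ht) where
  zero f := by
    have h := jacobiInt_X_mul (a := α - 1) (b := β) (c := γ) (t := t) f
    rw [sub_add_cancel] at h
    rw [C_0, sub_zero]
    exact h
  one f := by
    have h := jacobiInt_one_sub_X_mul (a := α) (b := β - 1) (c := γ) (t := t) f
    rw [sub_add_cancel] at h
    rw [C_1, LinearMap.neg_apply, ← map_neg, ← neg_mul, neg_sub]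
    exact h
  pole f := by
    have h := jacobiInt_X_sub_C_mul (a := α) (b := β) (c := γ - 1) ht f
    rw [sub_add_cancel] at h
    exact h
  parts f := by
    have h := jacobiInt_derivative (c := γ) hα hβ ht f
    rw [LinearMap.neg_apply]
    simp only [jacobiFunctional, LinearMap.coe_mk, AddHom.coe_mk]
    linarith

variable (α β γ)

/-- The monic orthogonal polynomial of degree `m + 1` for the generalized Jacobi weight. -/
def jacobiP (m : ℕ) (t : ℝ) : ℝ[X] := orthoLeft (jacobiInt α β γ t) m

/-- The polynomial of degree at most `m` dual to `X ^ m` for the generalized Jacobi weight. -/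
def jacobiQ (m : ℕ) (t : ℝ) : ℝ[X] := orthoRight (jacobiInt α β γ t) m

/-- The subleading coefficient of `jacobiP`. -/
def subleadingCoeff (m : ℕ) (t : ℝ) : ℝ := (jacobiP α β γ m t).coeff m

/-- The residue of the Lax pair at `0`: the diagonal entry of the residue matrix, before the shift
by `α / 2` that makes the matrix traceless. -/
def residueZero (m : ℕ) (t : ℝ) : ℝ :=
  α * jacobiInt (α - 1) β γ t (jacobiP α β γ m t * jacobiQ α β γ m t)

/-- The residue of the Lax pair at `t`: the diagonal entry of the residue matrix, before the shift
by `γ / 2` that makes the matrix traceless. -/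
def residuePole (m : ℕ) (t : ℝ) : ℝ :=
  γ * jacobiInt α β (γ - 1) t (jacobiP α β γ m t * jacobiQ α β γ m t)

/-- Up to sign, a diagonal entry of the commutator of the residue matrices at `0` and `t`. -/
def residueCommutator (m : ℕ) (t : ℝ) : ℝ :=
  α * jacobiInt (α - 1) β γ t (jacobiP α β γ m t * jacobiP α β γ m t)
      * (γ * jacobiInt α β (γ - 1) t (jacobiQ α β γ m t * jacobiQ α β γ m t))
    - γ * jacobiInt α β (γ - 1) t (jacobiP α β γ m t * jacobiP α β γ m t)
      * (α * jacobiInt (α - 1) β γ t (jacobiQ α β γ m t * jacobiQ α β γ m t))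

variable {α β γ} (hα : 0 < α) (hβ : 0 < β) (ht : t < 0) (m : ℕ)
include hα hβ ht

theorem det_hankelMatrix_jacobiInt_pos : 0 < (hankelMatrix (jacobiInt α β γ t) m).det :=
  det_hankelMatrix_pos
    (L := jacobiFunctional (c := γ) (by linarith : -1 < α) (by linarith : -1 < β) ht)
    fun _ hf => jacobiInt_mul_self_pos hα hβ ht hf

theorem isOrthoPair_jacobi :
    IsOrthoPair (jacobiFunctional (c := γ) (by linarith : -1 < α) (by linarith : -1 < β) ht) m
      (jacobiP α β γ m t) (jacobiQ α β γ m t) :=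
  isOrthoPair_ortho
    (L := jacobiFunctional (c := γ) (by linarith : -1 < α) (by linarith : -1 < β) ht)
    (det_hankelMatrix_jacobiInt_pos hα hβ ht m).ne'

/-- The diagonal residue at `1` is eliminated between the sum and the moment relation. -/
theorem residueZero_eq :
    residueZero α β γ m t
      = -(m + 1) - subleadingCoeff α β γ m t + (t - 1) * residuePole α β γ m t := by
  have h := isOrthoPair_jacobi (γ := γ) hα hβ ht m
  have hL := isPearson_jacobi (γ := γ) hα hβ ht
  have a := h.sum_left_right hL
  have b := h.moment_left_right hL
  change residueZero α β γ m t + _ + residuePole α β γ m t = _ at a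
  change _ + t * residuePole α β γ m t = subleadingCoeff α β γ m t at b
  linarith

theorem residueCommutator_sq {p r r0 r1 V : ℝ} (hp : p = subleadingCoeff α β γ m t)
    (hr : r = residuePole α β γ m t) (h1 : r1 = p - t * r) (h0 : r0 = -(m + 1) - r1 - r)
    (hV : V = r1 * (r1 - β) - t ^ 2 * (r * (r - γ)) - r0 * (r0 - α)
      + (t - 1) ^ 2 * (r * (r - γ))) :
    residueCommutator α β γ m t ^ 2 =
      V ^ 2 - 4 * (r1 * (r1 - β) - t ^ 2 * (r * (r - γ)) - t * V) * (r * (r - γ)) :=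
  (isOrthoPair_jacobi (γ := γ) hα hβ ht m).commutator_sq (isPearson_jacobi hα hβ ht) hp hr h1 h0 hV

theorem hasDerivAt_hankelMatrix (j k : Fin (m + 1)) :
    HasDerivAt (fun s => hankelMatrix (jacobiInt α β γ s) m j k)
      (-γ * jacobiInt α β (γ - 1) t (X ^ ((j : ℕ) + (k : ℕ)))) t :=
  hasDerivAt_jacobiInt γ (by linarith) (by linarith) ht _

theorem differentiableAt_inv_hankelMatrix (j k : Fin (m + 1)) :
    DifferentiableAt ℝ (fun s => (hankelMatrix (jacobiInt α β γ s) m)⁻¹ j k) t :=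
  differentiableAt_inv_apply
    (fun j k => (hasDerivAt_hankelMatrix hα hβ ht m j k).differentiableAt)
    (det_hankelMatrix_jacobiInt_pos hα hβ ht m).ne' j k

theorem exists_hasCoeffDerivAt_jacobiP :
    ∃ P' : ℝ[X], HasCoeffDerivAt (jacobiP α β γ m) P' t ∧ P'.natDegree ≤ m := by
  refine ⟨_, (hasCoeffDerivAt_ofFn (v := fun s => projCoeff (jacobiInt α β γ s) m)
    fun i => ?_).const_sub (X ^ (m + 1)), ?_⟩
  · simp only [projCoeff, Matrix.mulVec, dotProduct]
    exact DifferentiableAt.fun_sum fun j _ => (differentiableAt_inv_hankelMatrix hα hβ ht m i j).mul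
      (hasDerivAt_jacobiInt γ (by linarith) (by linarith) ht _).differentiableAt
  · rw [natDegree_neg]
    exact natDegree_ofFn_succ_le m _

theorem exists_hasCoeffDerivAt_jacobiQ :
    ∃ Q' : ℝ[X], HasCoeffDerivAt (jacobiQ α β γ m) Q' t ∧ Q'.natDegree ≤ m :=
  ⟨_, hasCoeffDerivAt_ofFn (v := fun s j => (hankelMatrix (jacobiInt α β γ s) m)⁻¹ j (Fin.last m))
    fun j => differentiableAt_inv_hankelMatrix hα hβ ht m j _, natDegree_ofFn_succ_le m _⟩

omit m in
/-- If the integrals of a curve of polynomials against `f` do not depend on the parameter, the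
derivative of the curve compensates that of the weight. -/
theorem jacobiInt_mul_of_hasCoeffDerivAt {F : ℝ → ℝ[X]} {F' f : ℝ[X]} {d : ℕ} {κ : ℝ}
    (hF : HasCoeffDerivAt F F' t) (hd : ∀ s, (F s).natDegree ≤ d)
    (hconst : ∀ s < 0, jacobiInt α β γ s (F s * f) = κ) :
    jacobiInt α β γ t (F' * f) = γ * jacobiInt α β (γ - 1) t (F t * f) := by
  have h1 := (hF.mul (hasCoeffDerivAt_const f t)).comp_jacobiInt (c := γ) (by linarith : -1 < α)
    (by linarith : -1 < β) ht (d := d + f.natDegree)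
    fun s => natDegree_mul_le.trans (Nat.add_le_add_right (hd s) _)
  have h2 : HasDerivAt (fun s => jacobiInt α β γ s (F s * f)) 0 t :=
    (hasDerivAt_const t κ).congr_of_eventuallyEq (by
      filter_upwards [Iio_mem_nhds ht] with s hs using hconst s hs)
  have h3 := h1.unique h2
  rw [mul_zero, add_zero] at h3
  linarith

theorem jacobiInt_deriv_jacobiP_mul {P' f : ℝ[X]} (hP : HasCoeffDerivAt (jacobiP α β γ m) P' t)
    (hf : f.natDegree ≤ m) :
    jacobiInt α β γ t (P' * f) = γ * jacobiInt α β (γ - 1) t (jacobiP α β γ m t * f) :=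
  jacobiInt_mul_of_hasCoeffDerivAt hα hβ ht hP (fun _ => natDegree_orthoLeft_le _ m)
    fun _ hs => (isOrthoPair_jacobi hα hβ hs m).left_mul f hf

theorem jacobiInt_deriv_jacobiQ_mul {Q' f : ℝ[X]} (hQ : HasCoeffDerivAt (jacobiQ α β γ m) Q' t)
    (hf : f.natDegree ≤ m) :
    jacobiInt α β γ t (Q' * f) = γ * jacobiInt α β (γ - 1) t (jacobiQ α β γ m t * f) :=
  jacobiInt_mul_of_hasCoeffDerivAt hα hβ ht hQ (fun _ => natDegree_orthoRight_le _ m)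
    fun _ hs => (isOrthoPair_jacobi hα hβ hs m).right_mul f hf

theorem hasDerivAt_subleadingCoeff :
    HasDerivAt (subleadingCoeff α β γ m) (residuePole α β γ m t) t := by
  obtain ⟨P', hP, hPd⟩ := exists_hasCoeffDerivAt_jacobiP (γ := γ) hα hβ ht m
  refine (hP m).congr_deriv ?_
  exact (isOrthoPair_jacobi (γ := γ) hα hβ ht m).coeff_deformation
    (M := jacobiFunctional (c := γ - 1) (by linarith : -1 < α) (by linarith : -1 < β) ht) hPd
    fun f hf => jacobiInt_deriv_jacobiP_mul hα hβ ht m hP hf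

omit m in
/-- Partial fractions for `1 / (x (x - t))`. -/
theorem mul_jacobiInt_sub_one_sub_one (f : ℝ[X]) :
    t * jacobiInt (α - 1) β (γ - 1) t f
      = jacobiInt α β (γ - 1) t f - jacobiInt (α - 1) β γ t f := by
  have h1 := jacobiInt_X_mul (a := α - 1) (b := β) (c := γ - 1) (t := t) f
  have h2 := jacobiInt_X_sub_C_mul (a := α - 1) (b := β) (c := γ - 1) ht f
  rw [sub_add_cancel] at h1 h2
  have hlin := map_sub (jacobiFunctional (c := γ - 1) (by linarith : -1 < α - 1)
    (by linarith : -1 < β) ht) (X * f) (C t * f)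
  rw [map_C_mul, ← sub_mul] at hlin
  simp only [jacobiFunctional, LinearMap.coe_mk, AddHom.coe_mk] at hlin
  rw [← h1, ← h2, hlin]
  ring

theorem hasDerivAt_residueZero :
    HasDerivAt (residueZero α β γ m) (-residueCommutator α β γ m t / t) t := by
  obtain ⟨P', hP, hPd⟩ := exists_hasCoeffDerivAt_jacobiP (γ := γ) hα hβ ht m
  obtain ⟨Q', hQ, hQd⟩ := exists_hasCoeffDerivAt_jacobiQ (γ := γ) hα hβ ht m
  have h := (((hP.mul hQ).comp_jacobiInt (c := γ) (by linarith : -1 < α - 1)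
    (by linarith : -1 < β) ht (d := m + 1 + m) fun s => natDegree_mul_le.trans
      (Nat.add_le_add (natDegree_orthoLeft_le _ m) (natDegree_orthoRight_le _ m))).const_mul α)
  refine h.congr_deriv ?_
  have key := (isOrthoPair_jacobi (γ := γ) hα hβ ht m).schlesinger (θ := α) (γ := γ)
    (isPearson_jacobi (γ := γ) hα hβ ht).pole (fun _ hf => jacobiInt_mul_self_pos hα hβ ht hf)
    (isPearson_jacobi (γ := γ) hα hβ ht).zero hPd hQd
    (fun f hf => jacobiInt_deriv_jacobiP_mul hα hβ ht m hP hf)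
    (fun f hf => jacobiInt_deriv_jacobiQ_mul hα hβ ht m hQ hf)
  simp only [jacobiFunctional, LinearMap.coe_mk, AddHom.coe_mk] at key
  change _ = residueCommutator α β γ m t at key
  rw [← key, eq_div_iff ht.ne]
  linear_combination (-α * γ) * mul_jacobiInt_sub_one_sub_one (γ := γ) hα hβ ht
    (jacobiP α β γ m t * jacobiQ α β γ m t)

/-- The derivative of the residue at `t` is read off from the one at `0` through the linear relation
between them, so that no double pole `1 / (x - t)²` has to be integrated. -/
theorem hasDerivAt_residuePole :
    HasDerivAt (residuePole α β γ m) (-residueCommutator α β γ m t / (t * (t - 1))) t := by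
  have ht1 : t - 1 ≠ 0 := by linarith
  have h := (((hasDerivAt_residueZero (γ := γ) hα hβ ht m).const_add ((m : ℝ) + 1)).add
    (hasDerivAt_subleadingCoeff (γ := γ) hα hβ ht m)).div ((hasDerivAt_id t).sub_const 1) ht1
  refine (h.congr_deriv ?_).congr_of_eventuallyEq ?_
  · have e := residueZero_eq (γ := γ) hα hβ ht m
    simp only [Pi.add_apply, id, e]
    field_simp [ht.ne]
    ring
  · filter_upwards [Iio_mem_nhds ht] with s hs
    have hs1 : s - 1 ≠ 0 := by have : s < 0 := hs; linarith
    simp only [Pi.add_apply, Pi.div_apply, id]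
    rw [residueZero_eq hα hβ hs, eq_div_iff hs1]
    ring

theorem mul_deriv_moment (k : ℕ) :
    t * (t - 1) * (-γ * jacobiInt α β (γ - 1) t (X ^ k)) =
      (k + (2 + α + β + γ)) * jacobiInt α β γ t (X ^ (k + 1))
        - (k + (1 + α + γ - γ * t)) * jacobiInt α β γ t (X ^ k) :=
  (isPearson_jacobi hα hβ ht).mul_pole_X_pow k

theorem hasDerivAt_hankelD :
    HasDerivAt (hankelD (m + 1) α β γ) (((hankelMatrix (jacobiInt α β γ t) m).adjugate *
      Matrix.of fun j k : Fin (m + 1) =>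
        -γ * jacobiInt α β (γ - 1) t (X ^ ((j : ℕ) + (k : ℕ)))).trace) t := by
  rw [show hankelD (m + 1) α β γ = fun s => (hankelMatrix (jacobiInt α β γ s) m).det from
    funext fun s => hankelD_eq_det α β γ s m]
  exact hasDerivAt_det (hasDerivAt_hankelMatrix hα hβ ht m)

/-- By Jacobi's formula the logarithmic derivative of the Hankel determinant is a trace, which the
relation `mul_deriv_moment` reduces to the subleading coefficient. -/
theorem hankelH_succ :
    hankelH (m + 1) α β γ t = -(2 * (m + 1) + α + β + γ) * subleadingCoeff α β γ m t
      + (m + 1) * γ * t - (m + 1) * ((m + 1) + α + γ) := by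
  have hD := det_hankelMatrix_jacobiInt_pos (γ := γ) hα hβ ht m
  have hD' : hankelD (m + 1) α β γ t ≠ 0 := by rw [hankelD_eq_det]; exact hD.ne'
  have hadj : (hankelMatrix (jacobiInt α β γ t) m).adjugate
      = (hankelMatrix (jacobiInt α β γ t) m).det • (hankelMatrix (jacobiInt α β γ t) m)⁻¹ := by
    rw [Matrix.inv_def, Ring.inverse_eq_inv', smul_smul, mul_inv_cancel₀ hD.ne', one_smul]
  have htr := trace_inv_hankelMatrix_mul (jacobiInt α β γ t) m hD.ne' (2 + α + β + γ)
    (1 + α + γ - γ * t)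
  have hmat : (Matrix.of fun j k : Fin (m + 1) =>
        ((j : ℝ) + (k : ℝ) + (2 + α + β + γ)) * jacobiInt α β γ t (X ^ ((j : ℕ) + (k : ℕ) + 1))
          - ((j : ℝ) + (k : ℝ) + (1 + α + γ - γ * t))
            * jacobiInt α β γ t (X ^ ((j : ℕ) + (k : ℕ))))
      = (t * (t - 1)) • Matrix.of fun j k : Fin (m + 1) =>
        -γ * jacobiInt α β (γ - 1) t (X ^ ((j : ℕ) + (k : ℕ))) := by
    ext j k
    rw [Matrix.smul_apply, Matrix.of_apply, Matrix.of_apply, smul_eq_mul,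
      mul_deriv_moment hα hβ ht]
    push_cast
    rfl
  rw [hmat, Matrix.mul_smul, Matrix.trace_smul, smul_eq_mul] at htr
  rw [hankelH, ((hasDerivAt_hankelD (γ := γ) hα hβ ht m).log hD').deriv, hadj, Matrix.smul_mul,
    Matrix.trace_smul, smul_eq_mul, hankelD_eq_det, mul_div_cancel_left₀ _ hD.ne', htr]
  simp only [subleadingCoeff, jacobiP]
  ring

theorem hasDerivAt_hankelHTilde :
    HasDerivAt (hankelHTilde (m + 1) α β γ) (-(2 * (m + 1) + α + β + γ) * residuePole α β γ m t
      + (m + 1) * γ + shiftOne (m + 1) α β γ) t := by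
  have h := ((((hasDerivAt_subleadingCoeff (γ := γ) hα hβ ht m).const_mul
    (-(2 * (m + 1) + α + β + γ))).add ((hasDerivAt_id t).const_mul ((m + 1) * γ))).sub_const
    (((m : ℝ) + 1) * ((m + 1) + α + γ))).add
    ((hasDerivAt_id t).const_mul (shiftOne (m + 1) α β γ)) |>.add_const (shiftTwo (m + 1) α β γ)
  refine (h.congr_deriv (by ring)).congr_of_eventuallyEq ?_
  filter_upwards [Iio_mem_nhds ht] with s hs
  simp only [hankelHTilde, hankelH_succ hα hβ hs, Pi.add_apply, id]

theorem satisfiesPVISigmaForm_succ :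
    SatisfiesPVISigmaForm ((α + β) / 2) ((β - α) / 2) ((2 * ((m : ℝ) + 1) + α + β) / 2)
      ((2 * ((m : ℝ) + 1) + α + β + 2 * γ) / 2) (hankelHTilde (m + 1) α β γ) t := by
  have h1 := hasDerivAt_hankelHTilde (γ := γ) hα hβ ht m
  have h2 : HasDerivAt (deriv (hankelHTilde (m + 1) α β γ)) (-(2 * (m + 1) + α + β + γ)
      * (-residueCommutator α β γ m t / (t * (t - 1)))) t := by
    refine ((((hasDerivAt_residuePole (γ := γ) hα hβ ht m).const_mul
      (-(2 * (m + 1) + α + β + γ))).add_const (((m : ℝ) + 1) * γ)).add_const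
      (shiftOne (m + 1) α β γ)).congr_of_eventuallyEq ?_
    filter_upwards [Iio_mem_nhds ht] with s hs
    exact (hasDerivAt_hankelHTilde hα hβ hs m).deriv
  refine ⟨h1.differentiableAt, h2.differentiableAt, ?_⟩
  have e2 : t * (t - 1) * deriv (deriv (hankelHTilde (m + 1) α β γ)) t
      = -(2 * (m + 1) + α + β + γ) * -residueCommutator α β γ m t := by
    have ht1 : t - 1 ≠ 0 := by linarith
    rw [h2.deriv]
    field_simp [ht.ne]
  rw [e2]
  refine sigma_form_of_lax_invariants (n := m + 1) (γ := γ) (p := subleadingCoeff α β γ m t)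
    (r := residuePole α β γ m t) rfl rfl rfl rfl rfl ?_ ?_ ?_
  · rw [neg_sq]
    exact residueCommutator_sq hα hβ ht m rfl rfl rfl rfl rfl
  · rw [hankelHTilde, hankelH_succ hα hβ ht]
    simp only [shiftOne, shiftTwo]
    push_cast
    ring
  · rw [h1.deriv]
    simp only [shiftOne]
    push_cast
    ring

end Jacobi

theorem hankelHTilde_zero (α β γ t : ℝ) :
    hankelHTilde 0 α β γ t = shiftOne 0 α β γ * t + shiftTwo 0 α β γ := by
  simp [hankelHTilde, hankelH, hankelD]

/-- For the empty determinant the shifted function is affine. -/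
theorem satisfiesPVISigmaForm_zero (α β γ t : ℝ) :
    SatisfiesPVISigmaForm ((α + β) / 2) ((β - α) / 2) ((2 * ((0 : ℕ) : ℝ) + α + β) / 2)
      ((2 * ((0 : ℕ) : ℝ) + α + β + 2 * γ) / 2) (hankelHTilde 0 α β γ) t := by
  have h : ∀ s, HasDerivAt (hankelHTilde 0 α β γ) (shiftOne 0 α β γ) s := fun s => by
    rw [funext (hankelHTilde_zero α β γ)]
    simpa using ((hasDerivAt_id s).const_mul (shiftOne 0 α β γ)).add_const (shiftTwo 0 α β γ)
  have h' : deriv (hankelHTilde 0 α β γ) = fun _ => shiftOne 0 α β γ :=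
    funext fun s => (h s).deriv
  refine ⟨(h t).differentiableAt, ?_, ?_⟩
  · rw [h']; exact differentiableAt_const _
  · rw [h', deriv_const, hankelHTilde_zero]
    simp only [shiftOne, shiftTwo]
    push_cast
    ring

end

theorem theorem1 (n : ℕ) (α β γ : ℝ) (hα : 0 < α) (hβ : 0 < β) :
    ∀ t : ℝ, t < 0 →
      0 < hankelD n α β γ t ∧
      DifferentiableAt ℝ (fun s : ℝ => hankelD n α β γ s) t ∧
      SatisfiesPVISigmaForm ((α + β) / 2) ((β - α) / 2) ((2 * (n : ℝ) + α + β) / 2)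
        ((2 * (n : ℝ) + α + β + 2 * γ) / 2) (fun s : ℝ => hankelHTilde n α β γ s) t := by
  intro t ht
  cases n with
  | zero => exact ⟨by simp [hankelD], by simp [hankelD], satisfiesPVISigmaForm_zero α β γ t⟩
  | succ m =>
    refine ⟨?_, (hasDerivAt_hankelD hα hβ ht m).differentiableAt, ?_⟩
    · rw [hankelD_eq_det]
      exact det_hankelMatrix_jacobiInt_pos hα hβ ht m
    · rw [Nat.cast_succ]
      exact satisfiesPVISigmaForm_succ hα hβ ht m
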